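/- Let $A$, $B$, $C$, $D$ be the complex matrices of sizes $16\times16$, $4\times16$, $16\times4$, $16\times4$ given as follows. For $\beta=\frac1{24}(8,-4,-1,1,-4,1,-1,0,\dots,0)$ and $\beta'=\frac1{24}(0,0,0,0,0,0,0,-8,4,4,1,-1,-1,1,0,0)$ in $\mathbb C^{16}$, the rows of $B$ are $\beta,\ \beta',\ -e_{15}^T,\ e_{16}^T$; the columns of $C$ are $3e_1,\ -3e_8,\ -e_{15},\ e_{16}$; $D$ is the matrix for which $Dx$ is the column vector with entries $$x_2,\ x_2-x_4,\ x_1-x_3-x_4,\ x_1+x_3-x_4,\ x_2+x_4,\ x_1-x_3+x_4,\ x_1+x_3+x_4,\ x_1,$$ $$x_1-x_3,\ x_1+x_3,\ x_2-x_3-x_4,\ x_2+x_3-x_4,\ x_2-x_3+x_4,\ x_2+x_3+x_4,\ x_4,\ 0;$$ and $A=DB$, written out entry by entry. For a vector $v$ let $v^{*3}$ be its componentwise cube. Define $f\colon\mathbb C^4\to\mathbb C^4$ and $F\colon\mathbb C^{16}\to\mathbb C^{16}$ by $$f(x)=x+\bigl((x_3x_1+x_4x_2)x_4,\ -(x_3x_1+x_4x_2)x_3,\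 x_4^3,\ 0\bigr),\qquad F(X)=X-(AX)^{*3}.$$ 1. $f$ is a bijective polynomial map with polynomial inverse of degree $7$, $$f^{-1}(y)=y+\begin{pmatrix}-y_1y_3y_4-y_2y_4^2\\ y_1y_3^2+y_2y_3y_4\\ -y_4^3\\ 0\end{pmatrix}+\begin{pmatrix}y_1y_4^4\\ -2y_1y_3y_4^3-y_2y_4^4\\ 0\\ 0\end{pmatrix}+\begin{pmatrix}0\\ y_1y_4^6\\ 0\\ 0\end{pmatrix}.$$ 2. $f(x)=x-B(Dx)^{*3}$ for all $x$ and $AC=D$. Moreover $f$ is cubic-homogeneous (that is, $f(x)=x-g(x,x,x)$ with $g$ a symmetric trilinear map) and is paired to $F$ through $B$ and $C$, that is, $\ker A=\ker B$, $BC=I_4$, and $f(x)=BF(Cx)$ for all $x\in\mathbb C^4$. 3. $A^2\neq0$ and $A^3=0$. 4. $F$ is a bijective polynomial map whose inverse is a polynomial map of degree at most $21$. 5. For every $\lambda\in\mathbb C\setminus\{0\}$ with $|\lambda|\neq1$ there is a bijective map $K_\lambda\colon\mathbb C^{16}\to\mathbb C^{16}$, analytic on all of $\mathbb C^{16}$ with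 inverse analytic on all of $\mathbb C^{16}$, such that $K_\lambda(0)=0$, $K_\lambda'(0)=I_{16}$ and $\lambda F(K_\lambda(X))=K_\lambda(\lambda X)$ for all $X\in\mathbb C^{16}$. Every map $L$ that is analytic near $0$ and satisfies $L(0)=0$, $L'(0)=I_{16}$ and $\lambda F(L(X))=L(\lambda X)$ for all $X$ near $0$ coincides with $K_\lambda$ near $0$. The map $K_\lambda$ is not a polynomial map. -/

import Mathlib

open scoped Matrix Topology

noncomputable section

/-- The cubic-linear map `X ↦ X - (A X)^{*3}`; powers of vectors are componentwise. -/
def cubicLinear {N : ℕ} (A : Matrix (Fin N) (Fin N) ℂ) (X : Fin N → ℂ) : Fin N → ℂ :=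
  X - (A *ᵥ X) ^ 3

/-- `f(x) = x - g(x,x,x)` for some symmetric trilinear `g`. -/
def IsCubicHomogeneous {n : ℕ} (f : (Fin n → ℂ) → (Fin n → ℂ)) : Prop :=
  ∃ g : MultilinearMap ℂ (fun _ : Fin 3 => Fin n → ℂ) (Fin n → ℂ),
    (∀ (σ : Equiv.Perm (Fin 3)) (v : Fin 3 → Fin n → ℂ), g (fun i => v (σ i)) = g v) ∧
    ∀ x, f x = x - g (fun _ => x)

/-- The cubic-homogeneous map `f` on `ℂⁿ` and the cubic-linear map of `A` on `ℂᴺ`, `N > n`, are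
paired through the matrices `B` and `C`. -/
structure IsPairedThrough {n N : ℕ} (f : (Fin n → ℂ) → (Fin n → ℂ))
    (A : Matrix (Fin N) (Fin N) ℂ) (B : Matrix (Fin n) (Fin N) ℂ)
    (C : Matrix (Fin N) (Fin n) ℂ) : Prop where
  dim_lt : n < N
  cubicHomogeneous : IsCubicHomogeneous f
  ker_eq : LinearMap.ker A.mulVecLin = LinearMap.ker B.mulVecLin
  right_inv : B * C = 1
  comm : ∀ x, f x = B *ᵥ cubicLinear A (C *ᵥ x)

/-- `f` is a polynomial map whose degree (the largest total degree of a component) is `d`. -/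
def IsPolynomialMapOfDegree {n m : ℕ} (f : (Fin n → ℂ) → (Fin m → ℂ)) (d : ℕ) : Prop :=
  ∃ p : Fin m → MvPolynomial (Fin n) ℂ,
    (∀ x i, f x i = MvPolynomial.eval x (p i)) ∧
    Finset.univ.sup (fun i => (p i).totalDegree) = d

/-- `f` is a polynomial map. -/
def IsPolynomialMap {n m : ℕ} (f : (Fin n → ℂ) → (Fin m → ℂ)) : Prop :=
  ∃ p : Fin m → MvPolynomial (Fin n) ℂ, ∀ x i, f x i = MvPolynomial.eval x (p i)

/-- `f` and `g` are two-sided inverses of each other. -/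
def AreInverse {n : ℕ} (f g : (Fin n → ℂ) → (Fin n → ℂ)) : Prop :=
  Function.LeftInverse g f ∧ Function.RightInverse g f

/-- `K` is analytic on all of `ℂⁿ`, bijective, and its inverse is analytic on all of `ℂⁿ`. -/
def IsAnalyticAutomorphism {n : ℕ} (K : (Fin n → ℂ) → (Fin n → ℂ)) : Prop :=
  AnalyticOnNhd ℂ K Set.univ ∧ ∃ G, AreInverse K G ∧ AnalyticOnNhd ℂ G Set.univ

/-- `K` is, near the origin, a normalized analytic solution of `lam F(K(X)) = K(lam X)`. -/
structure IsLocalPreconjugation {n : ℕ} (lam : ℂ) (F K : (Fin n → ℂ) → (Fin n → ℂ)) : Prop where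
  analyticAt : AnalyticAt ℂ K 0
  map_zero : K 0 = 0
  hasFDerivAt : HasFDerivAt K (ContinuousLinearMap.id ℂ (Fin n → ℂ)) 0
  conj : ∀ᶠ X in 𝓝 0, lam • F (K X) = K (lam • X)

/-- `K` is a (global) conjugation of `lam F` to `lam I`: a normalized analytic automorphism of
`ℂⁿ` with `lam F(K(X)) = K(lam X)` everywhere. -/
structure IsConjugation {n : ℕ} (lam : ℂ) (F K : (Fin n → ℂ) → (Fin n → ℂ)) : Prop where
  automorphism : IsAnalyticAutomorphism K
  map_zero : K 0 = 0
  hasFDerivAt : HasFDerivAt K (ContinuousLinearMap.id ℂ (Fin n → ℂ)) 0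
  conj : ∀ X, lam • F (K X) = K (lam • X)

/-- Van den Essen's map on `ℂ⁴`. -/
def essenMap (x : Fin 4 → ℂ) : Fin 4 → ℂ :=
  x + ![(x 2 * x 0 + x 3 * x 1) * x 3,
        -(x 2 * x 0 + x 3 * x 1) * x 2,
        x 3 ^ 3,
        0]

/-- The inverse of van den Essen's map. -/
def essenInv (y : Fin 4 → ℂ) : Fin 4 → ℂ :=
  y + ![-y 0 * y 2 * y 3 - y 1 * y 3 ^ 2, y 0 * y 2 ^ 2 + y 1 * y 2 * y 3, -y 3 ^ 3, 0]
    + ![y 0 * y 3 ^ 4, -2 * y 0 * y 2 * y 3 ^ 3 - y 1 * y 3 ^ 4, 0, 0]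
    + ![0, y 0 * y 3 ^ 6, 0, 0]

/-- The matrix `A` of the cubic-linear map on `ℂ¹⁶`. -/
def essenA : Matrix (Fin 16) (Fin 16) ℂ :=
  (1 / 24 : ℂ) •
    !![0, 0, 0, 0, 0, 0, 0, -8, 4, 4, 1, -1, -1, 1, 0, 0;
     0, 0, 0, 0, 0, 0, 0, -8, 4, 4, 1, -1, -1, 1, 0, -24;
     8, -4, -1, 1, -4, 1, -1, 0, 0, 0, 0, 0, 0, 0, 24, -24;
     8, -4, -1, 1, -4, 1, -1, 0, 0, 0, 0, 0, 0, 0, -24, -24;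
     0, 0, 0, 0, 0, 0, 0, -8, 4, 4, 1, -1, -1, 1, 0, 24;
     8, -4, -1, 1, -4, 1, -1, 0, 0, 0, 0, 0, 0, 0, 24, 24;
     8, -4, -1, 1, -4, 1, -1, 0, 0, 0, 0, 0, 0, 0, -24, 24;
     8, -4, -1, 1, -4, 1, -1, 0, 0, 0, 0, 0, 0, 0, 0, 0;
     8, -4, -1, 1, -4, 1, -1, 0, 0, 0, 0, 0, 0, 0, 24, 0;
     8, -4, -1, 1, -4, 1, -1, 0, 0, 0, 0, 0, 0, 0, -24, 0;
     0, 0, 0, 0, 0, 0, 0, -8, 4, 4, 1, -1, -1, 1, 24, -24;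
     0, 0, 0, 0, 0, 0, 0, -8, 4, 4, 1, -1, -1, 1, -24, -24;
     0, 0, 0, 0, 0, 0, 0, -8, 4, 4, 1, -1, -1, 1, 24, 24;
     0, 0, 0, 0, 0, 0, 0, -8, 4, 4, 1, -1, -1, 1, -24, 24;
     0, 0, 0, 0, 0, 0, 0, 0, 0, 0, 0, 0, 0, 0, 0, 24;
     0, 0, 0, 0, 0, 0, 0, 0, 0, 0, 0, 0, 0, 0, 0, 0]

/-- The matrix `B`. -/
def essenB : Matrix (Fin 4) (Fin 16) ℂ :=
  (1 / 24 : ℂ) •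
    !![8, -4, -1, 1, -4, 1, -1, 0, 0, 0, 0, 0, 0, 0, 0, 0;
     0, 0, 0, 0, 0, 0, 0, -8, 4, 4, 1, -1, -1, 1, 0, 0;
     0, 0, 0, 0, 0, 0, 0, 0, 0, 0, 0, 0, 0, 0, -24, 0;
     0, 0, 0, 0, 0, 0, 0, 0, 0, 0, 0, 0, 0, 0, 0, 24]

/-- The matrix `D`, whose rows are the linear forms in `f(x) = x - B (D x)^{*3}`. -/
def essenD : Matrix (Fin 16) (Fin 4) ℂ :=
  (!![0, 0, 1, 1, 0, 1, 1, 1, 1, 1, 0, 0, 0, 0, 0, 0;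
     1, 1, 0, 0, 1, 0, 0, 0, 0, 0, 1, 1, 1, 1, 0, 0;
     0, 0, -1, 1, 0, -1, 1, 0, -1, 1, -1, 1, -1, 1, 0, 0;
     0, -1, -1, -1, 1, 1, 1, 0, 0, 0, -1, -1, 1, 1, 1, 0] : Matrix (Fin 4) (Fin 16) ℂ)ᵀ

/-- The matrix `C`. -/
def essenC : Matrix (Fin 16) (Fin 4) ℂ :=
  (!![3, 0, 0, 0, 0, 0, 0, 0, 0, 0, 0, 0, 0, 0, 0, 0;
     0, 0, 0, 0, 0, 0, 0, -3, 0, 0, 0, 0, 0, 0, 0, 0;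
     0, 0, 0, 0, 0, 0, 0, 0, 0, 0, 0, 0, 0, 0, -1, 0;
     0, 0, 0, 0, 0, 0, 0, 0, 0, 0, 0, 0, 0, 0, 0, 1] : Matrix (Fin 4) (Fin 16) ℂ)ᵀ

end

open scoped Matrix Topology
open Filter Asymptotics

/-! Write F for the cubic-linear map of A. Since A = DB and f(x) = x - B(Dx)^{*3}, one has B∘F =
f∘B. Hence F(X) = Y forces BX = f⁻¹(BY), and then X = Y + (D f⁻¹(BY))^{*3}; this inverts F, with
degree at most 3·7.

For the conjugation, f is linear in (x_0, x_1) with matrix I + N(x_2, x_3), where N is nilpotent.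
The ansatz is k(x) = (M(x)(x_0, x_1), x_2 + c x_3³, x_3) with c = 1/(λ² - 1) and M(λx) = (I + N(x_2
+ c x_3³, x_3)) M(x). The entries of M are built from entire functions a, b, g, d, e of u = x_3⁴
satisfying q-difference equations with q = λ⁴. All of them come from one power series b
(`exists_entire_qDifference`). The determinant of M is ad - ubg, which is invariant under u ↦ qu,
hence equal to 1; so k is an automorphism.

The lift is K(X) = X + H(BX), where H(λy) - λH(y) = -λ(Dk(y))^{*3}. This is solved coefficientwise:
the divisors λ^m - λ, m ≥ 2, stay away from 0 because |λ| ≠ 1. A map with zero 1-jet that commutes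
with scaling by λ vanishes (`eq_zero_on_ball_of_apply_smul`); this yields both BH = k - id, so that
BK = kB, and the uniqueness of K. Finally, a polynomial K would make a(t⁴) a polynomial in t, which
its q-difference equation forbids by degree. -/

/-! ### Explicit linear algebra and the inverses of f and F -/

theorem essenMap_eq_vec (x : Fin 4 → ℂ) : essenMap x =
    ![x 0 + (x 2 * x 0 + x 3 * x 1) * x 3, x 1 - (x 2 * x 0 + x 3 * x 1) * x 2,
      x 2 + x 3 ^ 3, x 3] := by
  ext i
  fin_cases i
  · simp [essenMap]
  · simp [essenMap]
    ring
  · simp [essenMap]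
  · simp [essenMap]

theorem essenInv_eq_vec (y : Fin 4 → ℂ) : essenInv y =
    ![y 0 - y 0 * y 2 * y 3 - y 1 * y 3 ^ 2 + y 0 * y 3 ^ 4,
      y 1 + y 0 * y 2 ^ 2 + y 1 * y 2 * y 3 - 2 * y 0 * y 2 * y 3 ^ 3 - y 1 * y 3 ^ 4
        + y 0 * y 3 ^ 6,
      y 2 - y 3 ^ 3, y 3] := by
  ext i
  fin_cases i <;> simp [essenInv, Matrix.vecHead, Matrix.vecTail] <;> ring

theorem essenB_mul_essenC : essenB * essenC = 1 := by
  ext i j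
  fin_cases i <;> fin_cases j <;>
    simp [essenB, essenC, Matrix.mul_apply, Fin.sum_univ_succ] <;> norm_num

theorem essenD_mulVec (x : Fin 4 → ℂ) : essenD *ᵥ x =
    ![x 1, x 1 - x 3, x 0 - x 2 - x 3, x 0 + x 2 - x 3, x 1 + x 3, x 0 - x 2 + x 3,
      x 0 + x 2 + x 3, x 0, x 0 - x 2, x 0 + x 2, x 1 - x 2 - x 3, x 1 + x 2 - x 3,
      x 1 - x 2 + x 3, x 1 + x 2 + x 3, x 3, 0] := by
  ext i
  fin_cases i <;> simp [essenD, Matrix.mulVec, dotProduct, Fin.sum_univ_succ] <;> ring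

theorem essenB_mulVec (X : Fin 16 → ℂ) : essenB *ᵥ X =
    ![(1 / 24) * (8 * X 0 - 4 * X 1 - X 2 + X 3 - 4 * X 4 + X 5 - X 6),
      (1 / 24) * (-8 * X 7 + 4 * X 8 + 4 * X 9 + X 10 - X 11 - X 12 + X 13), -X 14, X 15] := by
  ext i
  fin_cases i <;> simp [essenB, Matrix.mulVec, dotProduct, Fin.sum_univ_succ] <;> ring

theorem essenA_eq : essenA = essenD * essenB := by
  rw [← Matrix.toLin'.injective.eq_iff]
  refine LinearMap.ext fun X => ?_
  rw [Matrix.toLin'_apply, Matrix.toLin'_apply, ← Matrix.mulVec_mulVec, essenB_mulVec,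
    essenD_mulVec]
  ext i
  fin_cases i <;> simp [essenA, Matrix.mulVec, dotProduct, Fin.sum_univ_succ] <;> ring

theorem essenMap_eq (x : Fin 4 → ℂ) : essenMap x = x - essenB *ᵥ (essenD *ᵥ x) ^ 3 := by
  rw [essenD_mulVec, essenB_mulVec, essenMap_eq_vec]
  ext i
  fin_cases i <;> simp <;> ring

theorem areInverse_essenMap : AreInverse essenMap essenInv := by
  constructor <;> intro x
  · rw [essenMap_eq_vec, essenInv_eq_vec]
    ext i
    fin_cases i <;> simp <;> ring
  · rw [essenInv_eq_vec, essenMap_eq_vec]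
    ext i
    fin_cases i <;> simp <;> ring

theorem essenA_mul_essenC : essenA * essenC = essenD := by
  rw [essenA_eq, Matrix.mul_assoc, essenB_mul_essenC, Matrix.mul_one]

theorem essenD_mulVec_injective : Function.Injective (essenD.mulVec) := by
  intro x y h
  have h' : ∀ i, (essenD *ᵥ x) i = (essenD *ᵥ y) i := fun i => congrFun h i
  simp only [essenD_mulVec] at h'
  -- The entries 7, 0, 9, 14 of Dx are x_0, x_1, x_0 + x_2, x_3, which determine x.
  have h0 := h' 7
  have h1 := h' 0
  have h2 := h' 9
  have h3 := h' 14
  simp at h0 h1 h2 h3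
  ext i
  fin_cases i
  · exact h0
  · exact h1
  · simpa [h0] using h2
  · exact h3

theorem essenA_mulVec (X : Fin 16 → ℂ) : essenA *ᵥ X = essenD *ᵥ (essenB *ᵥ X) := by
  rw [essenA_eq, Matrix.mulVec_mulVec]

theorem ker_essenA : LinearMap.ker essenA.mulVecLin = LinearMap.ker essenB.mulVecLin := by
  ext X
  simp only [LinearMap.mem_ker, Matrix.mulVecLin_apply, essenA_mulVec]
  constructor
  · intro h
    exact essenD_mulVec_injective (by simpa using h)
  · intro h
    rw [h, Matrix.mulVec_zero]

/-- Every map `x - B (D x)^{*3}` is cubic-homogeneous. -/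
theorem isCubicHomogeneous_sub_mulVec {n N : ℕ} (B : Matrix (Fin n) (Fin N) ℂ)
    (D : Matrix (Fin N) (Fin n) ℂ) : IsCubicHomogeneous fun x => x - B *ᵥ (D *ᵥ x) ^ 3 := by
  refine ⟨B.mulVecLin.compMultilinearMap
    ((MultilinearMap.mkPiAlgebra ℂ (Fin 3) (Fin N → ℂ)).compLinearMap fun _ => D.mulVecLin),
    fun σ v => ?_, fun x => ?_⟩
  · simp only [LinearMap.compMultilinearMap_apply, MultilinearMap.compLinearMap_apply,
      MultilinearMap.mkPiAlgebra_apply]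
    rw [Equiv.prod_comp σ fun i => D.mulVecLin (v i)]
  · simp

theorem isPairedThrough_essen : IsPairedThrough essenMap essenA essenB essenC where
  dim_lt := by norm_num
  cubicHomogeneous := by
    rw [funext essenMap_eq]
    exact isCubicHomogeneous_sub_mulVec _ _
  ker_eq := ker_essenA
  right_inv := essenB_mul_essenC
  comm x := by
    rw [essenMap_eq, cubicLinear, Matrix.mulVec_sub, Matrix.mulVec_mulVec, essenB_mul_essenC,
      Matrix.one_mulVec, Matrix.mulVec_mulVec, essenA_mul_essenC]

theorem essenA_sq_ne_zero : essenA ^ 2 ≠ 0 := by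
  intro h
  have h1 : essenA *ᵥ (essenA *ᵥ fun i => if i = 15 then 1 else 0) = 0 := by
    rw [Matrix.mulVec_mulVec, ← sq, h, Matrix.zero_mulVec]
  have h2 := congrFun h1 2
  simp [essenA_mulVec, essenB_mulVec, essenD_mulVec] at h2

/-- BD sends x to (0, 0, -x_3, 0), so (BD)² = 0 and A³ = D(BD)²B = 0. -/
theorem essenA_cube : essenA ^ 3 = 0 := by
  rw [← Matrix.toLin'.injective.eq_iff]
  refine LinearMap.ext fun X => ?_
  rw [Matrix.toLin'_apply, pow_succ, sq, ← Matrix.mulVec_mulVec, ← Matrix.mulVec_mulVec]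
  simp only [essenA_mulVec, essenD_mulVec]
  ext i
  fin_cases i <;> simp [essenB_mulVec] <;> ring

theorem essenB_mulVec_cubicLinear (X : Fin 16 → ℂ) :
    essenB *ᵥ cubicLinear essenA X = essenMap (essenB *ᵥ X) := by
  rw [cubicLinear, Matrix.mulVec_sub, essenMap_eq, essenA_mulVec]

theorem areInverse_cubicLinear : AreInverse (cubicLinear essenA)
    fun Y => Y + (essenD *ᵥ essenInv (essenB *ᵥ Y)) ^ 3 := by
  constructor
  · intro X
    simp only [essenB_mulVec_cubicLinear, areInverse_essenMap.1 _]
    rw [cubicLinear, essenA_mulVec, sub_add_cancel]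
  · intro Y
    have h : essenB *ᵥ (Y + (essenD *ᵥ essenInv (essenB *ᵥ Y)) ^ 3) =
        essenInv (essenB *ᵥ Y) := by
      have h1 := areInverse_essenMap.2 (essenB *ᵥ Y)
      rw [essenMap_eq] at h1
      rw [Matrix.mulVec_add]
      nth_rewrite 1 [← h1]
      rw [sub_add_cancel]
    simp only [cubicLinear]
    rw [essenA_mulVec, h, add_sub_cancel_right]

/-! ### Polynomial maps and degree bounds -/

namespace MvPolynomial

variable {σ R : Type*} [CommRing R]

theorem totalDegree_add_le_of_le {p q : MvPolynomial σ R} {d : ℕ} (hp : p.totalDegree ≤ d)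
    (hq : q.totalDegree ≤ d) : (p + q).totalDegree ≤ d :=
  (totalDegree_add p q).trans (max_le hp hq)

theorem totalDegree_mul_le_of_le {p q : MvPolynomial σ R} {a b : ℕ} (hp : p.totalDegree ≤ a)
    (hq : q.totalDegree ≤ b) : (p * q).totalDegree ≤ a + b :=
  (totalDegree_mul p q).trans (add_le_add hp hq)

theorem totalDegree_pow_le_of_le {p : MvPolynomial σ R} {a : ℕ} (hp : p.totalDegree ≤ a)
    (n : ℕ) : (p ^ n).totalDegree ≤ n * a :=
  (totalDegree_pow p n).trans (Nat.mul_le_mul_left n hp)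

end MvPolynomial

section polynomials

open MvPolynomial

/-- The polynomials `∑ j, A i j * X j`. -/
noncomputable def linearForms {m n : ℕ} (A : Matrix (Fin m) (Fin n) ℂ) (i : Fin m) :
    MvPolynomial (Fin n) ℂ :=
  ∑ j, C (A i j) * X j

theorem eval_linearForms {m n : ℕ} (A : Matrix (Fin m) (Fin n) ℂ) (x : Fin n → ℂ) (i : Fin m) :
    eval x (linearForms A i) = (A *ᵥ x) i := by
  simp [linearForms, Matrix.mulVec, dotProduct]

theorem totalDegree_sum_C_mul_le {ι σ : Type*} [Fintype ι] (c : ι → ℂ)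
    (p : ι → MvPolynomial σ ℂ) {d : ℕ} (hp : ∀ j, (p j).totalDegree ≤ d) :
    (∑ j, C (c j) * p j).totalDegree ≤ d := by
  refine totalDegree_finsetSum_le fun j _ => ?_
  simpa using totalDegree_mul_le_of_le (a := 0) (totalDegree_C (c j)).le (hp j)

theorem totalDegree_linearForms_le {m n : ℕ} (A : Matrix (Fin m) (Fin n) ℂ) (i : Fin m) :
    (linearForms A i).totalDegree ≤ 1 :=
  totalDegree_sum_C_mul_le _ _ fun j => (totalDegree_X j).le

/-- The inverse of van den Essen's map, with entries in an arbitrary polynomial ring. -/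
noncomputable def essenInvPoly {σ : Type*} (y : Fin 4 → MvPolynomial σ ℂ) :
    Fin 4 → MvPolynomial σ ℂ :=
  ![y 0 + (-(y 0 * y 2 * y 3) + -(y 1 * y 3 ^ 2) + y 0 * y 3 ^ 4),
    y 0 * y 3 ^ 6 + (y 1 + y 0 * y 2 ^ 2 + y 1 * y 2 * y 3 + C (-2) * (y 0 * y 2 * y 3 ^ 3)
      + -(y 1 * y 3 ^ 4)),
    y 2 + -y 3 ^ 3,
    y 3]

theorem eval_essenInvPoly {σ : Type*} (y : Fin 4 → MvPolynomial σ ℂ) (x : σ → ℂ) (i : Fin 4) :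
    eval x (essenInvPoly y i) = essenInv (fun j => eval x (y j)) i := by
  rw [essenInv_eq_vec]
  fin_cases i <;> simp [essenInvPoly] <;> ring

/-- Everything in the second component except y_0 y_3⁶: a strict bound below 7 keeps that monomial
from cancelling, so the degree is exactly 7. -/
theorem totalDegree_essenInvPoly_lower {σ : Type*} {y : Fin 4 → MvPolynomial σ ℂ}
    (hy : ∀ j, (y j).totalDegree ≤ 1) :
    (y 1 + y 0 * y 2 ^ 2 + y 1 * y 2 * y 3 + C (-2) * (y 0 * y 2 * y 3 ^ 3)
      + -(y 1 * y 3 ^ 4)).totalDegree ≤ 6 := by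
  have hm := @totalDegree_mul_le_of_le σ ℂ _
  have hp := @totalDegree_pow_le_of_le σ ℂ _
  have hC : (C (-2) : MvPolynomial σ ℂ).totalDegree ≤ 0 := (totalDegree_C _).le
  refine totalDegree_add_le_of_le (totalDegree_add_le_of_le (totalDegree_add_le_of_le
    (totalDegree_add_le_of_le ((hy 1).trans (by norm_num)) ?_) ?_) ?_) ?_
  · exact (hm (hy 0) (hp (hy 2) 2)).trans (by norm_num)
  · exact (hm (hm (hy 1) (hy 2)) (hy 3)).trans (by norm_num)
  · exact (hm hC (hm (hm (hy 0) (hy 2)) (hp (hy 3) 3))).trans (by norm_num)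
  · rw [totalDegree_neg]
    exact (hm (hy 1) (hp (hy 3) 4)).trans (by norm_num)

theorem totalDegree_essenInvPoly_le {σ : Type*} {y : Fin 4 → MvPolynomial σ ℂ}
    (hy : ∀ j, (y j).totalDegree ≤ 1) (i : Fin 4) : (essenInvPoly y i).totalDegree ≤ 7 := by
  have hm := @totalDegree_mul_le_of_le σ ℂ _
  have hp := @totalDegree_pow_le_of_le σ ℂ _
  fin_cases i
  · refine totalDegree_add_le_of_le ((hy 0).trans (by norm_num)) (totalDegree_add_le_of_le
      (totalDegree_add_le_of_le ?_ ?_) ?_)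
    · rw [totalDegree_neg]
      exact (hm (hm (hy 0) (hy 2)) (hy 3)).trans (by norm_num)
    · rw [totalDegree_neg]
      exact (hm (hy 1) (hp (hy 3) 2)).trans (by norm_num)
    · exact (hm (hy 0) (hp (hy 3) 4)).trans (by norm_num)
  · exact totalDegree_add_le_of_le ((hm (hy 0) (hp (hy 3) 6)).trans (by norm_num))
      ((totalDegree_essenInvPoly_lower hy).trans (by norm_num))
  · refine totalDegree_add_le_of_le ((hy 2).trans (by norm_num)) ?_
    rw [totalDegree_neg]
    exact (hp (hy 3) 3).trans (by norm_num)
  · exact (hy 3).trans (by norm_num)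

theorem isPolynomialMapOfDegree_essenInv : IsPolynomialMapOfDegree essenInv 7 := by
  have hX : ∀ j : Fin 4, (X j : MvPolynomial (Fin 4) ℂ).totalDegree ≤ 1 :=
    fun j => (totalDegree_X j).le
  refine ⟨essenInvPoly X, fun x i => by simp [eval_essenInvPoly], le_antisymm
    (Finset.sup_le fun i _ => totalDegree_essenInvPoly_le hX i) ?_⟩
  have hlead : (X 0 * X 3 ^ 6 : MvPolynomial (Fin 4) ℂ).totalDegree = 7 := by
    rw [totalDegree_mul_of_isDomain (X_ne_zero _) (pow_ne_zero _ (X_ne_zero _)),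
      totalDegree_X_pow, totalDegree_X]
  have h : (essenInvPoly X (1 : Fin 4) : MvPolynomial (Fin 4) ℂ).totalDegree = 7 := by
    rw [← hlead]
    refine totalDegree_add_eq_left_of_totalDegree_lt ?_
    rw [hlead]
    exact Nat.lt_succ_of_le (totalDegree_essenInvPoly_lower hX)
  rw [← h]
  exact Finset.le_sup (f := fun i : Fin 4 => (essenInvPoly X i).totalDegree) (Finset.mem_univ 1)

theorem isPolynomialMap_essenMap : IsPolynomialMap essenMap := by
  refine ⟨![X 0 + (X 2 * X 0 + X 3 * X 1) * X 3, X 1 - (X 2 * X 0 + X 3 * X 1) * X 2,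
    X 2 + X 3 ^ 3, X 3], fun x i => ?_⟩
  rw [essenMap_eq_vec]
  fin_cases i <;> simp

theorem isPolynomialMap_cubicLinear {N : ℕ} (A : Matrix (Fin N) (Fin N) ℂ) :
    IsPolynomialMap (cubicLinear A) :=
  ⟨fun i => X i - linearForms A i ^ 3, fun x i => by simp [cubicLinear, eval_linearForms]⟩

theorem exists_isPolynomialMapOfDegree_cubicLinear_inverse :
    ∃ d ≤ 21, IsPolynomialMapOfDegree
      (fun Y => Y + (essenD *ᵥ essenInv (essenB *ᵥ Y)) ^ 3) d := by
  let p : Fin 16 → MvPolynomial (Fin 16) ℂ := fun i =>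
    X i + (∑ j, C (essenD i j) * essenInvPoly (linearForms essenB) j) ^ 3
  refine ⟨Finset.univ.sup fun i => (p i).totalDegree, Finset.sup_le fun i _ => ?_, p,
    fun x i => ?_, rfl⟩
  · exact totalDegree_add_le_of_le ((totalDegree_X i).le.trans (by norm_num))
      (totalDegree_pow_le_of_le (totalDegree_sum_C_mul_le _ _ fun j =>
        totalDegree_essenInvPoly_le (totalDegree_linearForms_le _) j) 3)
  · simp only [p, map_add, map_pow, map_sum, map_mul, eval_X, eval_C, eval_essenInvPoly,
      eval_linearForms]
    rfl

end polynomials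

/-! ### Entire power series and small divisors -/

theorem HasSum.congr_of_eq {f g : ℕ → ℂ} {s : ℂ} (h : ∀ n, f n = g n) (hf : HasSum f s) :
    HasSum g s :=
  funext h ▸ hf

/-- A power series whose coefficients decay faster than every geometric sequence is entire. -/
theorem differentiable_tsum_mul_pow {c : ℕ → ℂ} (hc : ∀ r : ℝ, Summable fun n => ‖c n‖ * r ^ n) :
    Differentiable ℂ fun z => ∑' n, c n * z ^ n := by
  intro z
  have h := Complex.differentiableOn_tsum_of_summable_norm (F := fun n (z : ℂ) => c n * z ^ n)
    (U := Metric.ball 0 (‖z‖ + 1)) (hc (‖z‖ + 1)) (fun n => by fun_prop) Metric.isOpen_ball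
    (fun n w hw => by
      rw [norm_mul, norm_pow]
      have hw' : ‖w‖ < ‖z‖ + 1 := by simpa using hw
      gcongr)
  exact h.differentiableAt (Metric.isOpen_ball.mem_nhds (by simp))

theorem summable_mul_pow {c : ℕ → ℂ} (hc : ∀ r : ℝ, Summable fun n => ‖c n‖ * r ^ n) (z : ℂ) :
    Summable fun n => c n * z ^ n :=
  Summable.of_norm (by simpa using hc ‖z‖)

theorem Differentiable.exists_hasSum {φ : ℂ → ℂ} (hφ : Differentiable ℂ φ) :
    ∃ c : ℕ → ℂ, (∀ r : ℝ, Summable fun n => ‖c n‖ * r ^ n) ∧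
      ∀ z, HasSum (fun n => c n * z ^ n) (φ z) := by
  have h : ∀ z, HasSum (fun n => ((n.factorial : ℂ)⁻¹ * iteratedDeriv n φ 0) * z ^ n) (φ z) := by
    intro z
    refine HasSum.congr_of_eq (fun n => ?_) (Complex.hasSum_taylorSeries_of_entire hφ 0 z)
    simp only [smul_eq_mul, sub_zero]
    ring
  refine ⟨_, fun r => ?_, h⟩
  have h1 := (h r).summable.norm
  refine Summable.of_norm ?_
  simpa using h1

section

variable {lam : ℂ} (h0 : lam ≠ 0) (h1 : ‖lam‖ ≠ 1)
include h1

/-- |λ|^n is at least as far from 1 as |λ|. The bound is uniform in n, so division by these numbers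
preserves entireness. -/
theorem abs_norm_sub_one_le_norm_pow_sub_one {n : ℕ} (hn : n ≠ 0) :
    |‖lam‖ - 1| ≤ ‖lam ^ n - 1‖ := by
  have h := abs_norm_sub_norm_le (lam ^ n) 1
  rw [norm_pow, norm_one] at h
  refine le_trans ?_ h
  rcases lt_or_gt_of_ne h1 with hl | hl
  · have := pow_le_of_le_one (norm_nonneg lam) hl.le hn
    rw [abs_of_nonpos (by linarith), abs_of_nonpos (by linarith)]
    linarith
  · have := le_self_pow₀ hl.le hn
    rw [abs_of_nonneg (by linarith), abs_of_nonneg (by linarith)]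
    linarith

theorem pow_sub_one_ne_zero_of_norm_ne_one {n : ℕ} (hn : n ≠ 0) : lam ^ n - 1 ≠ 0 := by
  have h := abs_norm_sub_one_le_norm_pow_sub_one h1 hn
  have : 0 < |‖lam‖ - 1| := abs_pos.mpr (sub_ne_zero.mpr h1)
  exact norm_pos_iff.mp (this.trans_le h)

include h0

/-- The equation `lam ^ d * ψ (lam z) - lam * ψ z = φ z` has an entire solution if `2 ≤ d`. -/
theorem exists_entire_solution {φ : ℂ → ℂ} (hφ : Differentiable ℂ φ) {d : ℕ} (hd : 2 ≤ d) :
    ∃ ψ : ℂ → ℂ, Differentiable ℂ ψ ∧ ∀ z, lam ^ d * ψ (lam * z) - lam * ψ z = φ z := by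
  obtain ⟨c, hc, hs⟩ := hφ.exists_hasSum
  -- The divisor is λ(λ^(d+n-1) - 1), whose exponent is positive because d ≥ 2.
  have hne : ∀ n, lam ^ (d + n) - lam ≠ 0 := fun n => by
    obtain ⟨e, rfl⟩ := Nat.exists_eq_add_of_le hd
    rw [show 2 + e + n = (1 + e + n) + 1 by ring, pow_succ, ← sub_one_mul]
    exact mul_ne_zero (pow_sub_one_ne_zero_of_norm_ne_one h1 (by omega)) h0
  have hle : ∀ n, ‖lam‖ * |‖lam‖ - 1| ≤ ‖lam ^ (d + n) - lam‖ := fun n => by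
    obtain ⟨e, rfl⟩ := Nat.exists_eq_add_of_le hd
    rw [show 2 + e + n = (1 + e + n) + 1 by ring, pow_succ, ← sub_one_mul, norm_mul, mul_comm]
    gcongr
    exact abs_norm_sub_one_le_norm_pow_sub_one h1 (by omega)
  have hpos : 0 < ‖lam‖ * |‖lam‖ - 1| :=
    mul_pos (norm_pos_iff.mpr h0) (abs_pos.mpr (sub_ne_zero.mpr h1))
  have hb : ∀ r : ℝ, Summable fun n => ‖c n / (lam ^ (d + n) - lam)‖ * r ^ n := by
    intro r
    refine Summable.of_norm_bounded ((hc |r|).mul_left (‖lam‖ * |‖lam‖ - 1|)⁻¹) fun n => ?_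
    rw [norm_mul, norm_norm, norm_div, norm_pow, Real.norm_eq_abs, ← mul_assoc, div_eq_inv_mul]
    gcongr
    exact hle n
  refine ⟨_, differentiable_tsum_mul_pow hb, fun z => ?_⟩
  refine HasSum.unique ?_ (hs z)
  refine HasSum.congr_of_eq (fun n => ?_)
    (((summable_mul_pow hb (lam * z)).hasSum.mul_left (lam ^ d)).sub
      ((summable_mul_pow hb z).hasSum.mul_left lam))
  calc _ = (lam ^ (d + n) - lam) * (c n / (lam ^ (d + n) - lam)) * z ^ n := by ring
    _ = c n * z ^ n := by rw [mul_div_cancel₀ _ (hne n)]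

end

/-! ### The q-difference equations behind the conjugation of f -/

/-- The Taylor coefficients of the entire function solving the `q`-difference equation
`lam² b(q² v) - b(q v) = lam² b(q v) - b(v) + v lam² b(q v)`, where `q = lam⁴`. -/
noncomputable def qCoeff (lam : ℂ) : ℕ → ℂ
  | 0 => 1 / (lam ^ 2 - 1)
  | m + 1 => lam ^ 2 * (lam ^ 4) ^ m /
      (((lam ^ 4) ^ (m + 1) - 1) * (lam ^ 2 * (lam ^ 4) ^ (m + 1) - 1)) * qCoeff lam m

section

variable {lam : ℂ} (h0 : lam ≠ 0) (h1 : ‖lam‖ ≠ 1)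
include h0 h1

theorem tendsto_qCoeff_ratio : Tendsto (fun m : ℕ => lam ^ 2 * (lam ^ 4) ^ m /
      (((lam ^ 4) ^ (m + 1) - 1) * (lam ^ 2 * (lam ^ 4) ^ (m + 1) - 1))) atTop (𝓝 0) := by
  rcases lt_or_gt_of_ne h1 with hl | hl
  · have hq : ‖lam ^ 4‖ < 1 := by
      rw [norm_pow]
      exact pow_lt_one₀ (norm_nonneg _) hl (by norm_num)
    have h := tendsto_pow_atTop_nhds_zero_of_norm_lt_one hq
    have h' := h.comp (tendsto_add_atTop_nat 1)
    have := (h.const_mul (lam ^ 2)).div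
      ((h'.sub_const 1).mul ((h'.const_mul (lam ^ 2)).sub_const 1)) (by norm_num)
    simpa [Pi.div_def] using this
  -- For |λ| > 1, divide numerator and denominator by q^(2(m+1)); the denominator then tends to λ².
  · have hp : ‖(lam ^ 4)⁻¹‖ < 1 := by
      rw [norm_inv, norm_pow]
      exact inv_lt_one_of_one_lt₀ (one_lt_pow₀ hl (by norm_num))
    have h := (tendsto_pow_atTop_nhds_zero_of_norm_lt_one hp).comp (tendsto_add_atTop_nat 1)
    have := (h.const_mul (lam ^ 2 * (lam ^ 4)⁻¹)).div
      ((h.const_sub 1).mul (h.const_sub (lam ^ 2))) (by simpa using h0)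
    simp only [mul_zero, zero_div] at this
    refine this.congr fun m => ?_
    have hq : (lam ^ 4) ^ m ≠ 0 := pow_ne_zero _ (pow_ne_zero _ h0)
    have hq' : (lam ^ 4) ^ (m + 1) ≠ 0 := pow_ne_zero _ (pow_ne_zero _ h0)
    simp only [Function.comp, Pi.div_apply, inv_pow]
    rw [show (1 : ℂ) - ((lam ^ 4) ^ (m + 1))⁻¹ = ((lam ^ 4) ^ (m + 1) - 1) / (lam ^ 4) ^ (m + 1) by
        field_simp,
      show lam ^ 2 - ((lam ^ 4) ^ (m + 1))⁻¹
        = (lam ^ 2 * (lam ^ 4) ^ (m + 1) - 1) / (lam ^ 4) ^ (m + 1) by field_simp,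
      div_mul_div_comm, div_div_eq_mul_div]
    congr 1
    rw [pow_succ]
    field_simp
    ring

theorem summable_norm_qCoeff (r : ℝ) : Summable fun n => ‖qCoeff lam n‖ * r ^ n := by
  have h := ((tendsto_qCoeff_ratio h0 h1).norm.mul_const |r|)
  rw [norm_zero, zero_mul] at h
  refine summable_of_ratio_norm_eventually_le (r := 1 / 2) (by norm_num) ?_
  filter_upwards [h.eventually_le_const (show (0 : ℝ) < 1 / 2 by norm_num)] with n hn
  rw [qCoeff, norm_mul (_ / _)]
  simp only [norm_mul (_ : ℝ), norm_pow (_ : ℝ), Real.norm_eq_abs, abs_norm]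
  rw [pow_succ |r|]
  calc _ = (‖lam ^ 2 * (lam ^ 4) ^ n / (((lam ^ 4) ^ (n + 1) - 1)
        * (lam ^ 2 * (lam ^ 4) ^ (n + 1) - 1))‖ * |r|) * (‖qCoeff lam n‖ * |r| ^ n) := by ring
    _ ≤ _ := by gcongr

omit h0 in
-- The coefficient comparison for the q-difference equation; its left factor is (q^n - 1)(λ²q^n - 1)
-- with n = m + 1.
theorem qCoeff_succ_mul (m : ℕ) :
    (lam ^ 2 * (lam ^ 4) ^ (2 * (m + 1)) - (1 + lam ^ 2) * (lam ^ 4) ^ (m + 1) + 1)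
      * qCoeff lam (m + 1) = lam ^ 2 * (lam ^ 4) ^ m * qCoeff lam m := by
  have e1 : (lam ^ 4) ^ (m + 1) - 1 ≠ 0 := by
    rw [← pow_mul]
    exact pow_sub_one_ne_zero_of_norm_ne_one h1 (by omega)
  have e2 : lam ^ 2 * (lam ^ 4) ^ (m + 1) - 1 ≠ 0 := by
    rw [← pow_mul, ← pow_add]
    exact pow_sub_one_ne_zero_of_norm_ne_one h1 (by omega)
  rw [qCoeff, show lam ^ 2 * (lam ^ 4) ^ (2 * (m + 1)) - (1 + lam ^ 2) * (lam ^ 4) ^ (m + 1) + 1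
    = ((lam ^ 4) ^ (m + 1) - 1) * (lam ^ 2 * (lam ^ 4) ^ (m + 1) - 1) by ring, ← mul_assoc,
    mul_div_cancel₀ _ (mul_ne_zero e1 e2)]

theorem exists_entire_qDifference : ∃ b : ℂ → ℂ, Differentiable ℂ b ∧ b 0 = 1 / (lam ^ 2 - 1) ∧
    ∀ v, lam ^ 2 * b (lam ^ 4 * (lam ^ 4 * v)) - b (lam ^ 4 * v)
      = lam ^ 2 * b (lam ^ 4 * v) - b v + v * (lam ^ 2 * b (lam ^ 4 * v)) := by
  have hs := summable_norm_qCoeff h0 h1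
  refine ⟨_, differentiable_tsum_mul_pow hs, ?_, fun v => ?_⟩
  · rw [tsum_eq_single 0 fun n hn => by simp [hn]]
    simp [qCoeff]
  · have H := fun z => (summable_mul_pow hs z).hasSum
    have hl := (((H (lam ^ 4 * (lam ^ 4 * v))).mul_left (lam ^ 2)).sub
      ((H (lam ^ 4 * v)).mul_left (1 + lam ^ 2))).add (H v)
    have hr := (H (lam ^ 4 * v)).mul_left (lam ^ 2 * v)
    have hr' : HasSum (fun n => lam ^ 2 * (qCoeff lam n * (lam ^ 4 * (lam ^ 4 * v)) ^ n)
        - (1 + lam ^ 2) * (qCoeff lam n * (lam ^ 4 * v) ^ n) + qCoeff lam n * v ^ n)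
        (lam ^ 2 * v * ∑' n, qCoeff lam n * (lam ^ 4 * v) ^ n) := by
      -- The constant term drops out because q^0 - 1 = 0, so b(0) is free; the choice 1/(λ² - 1)
      -- gives a(0) = d(0) = 1.
      rw [← hasSum_nat_add_iff' 1]
      simp only [Finset.sum_range_one, pow_zero, mul_one]
      rw [show lam ^ 2 * qCoeff lam 0 - (1 + lam ^ 2) * qCoeff lam 0 + qCoeff lam 0 = 0 by ring,
        sub_zero]
      refine HasSum.congr_of_eq (fun n => ?_) hr
      have := qCoeff_succ_mul h1 n
      simp only [mul_pow]
      linear_combination (-v ^ (n + 1)) * this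
    linear_combination hl.unique hr'

end

/-- The entire functions of `t⁴` from which the conjugation of van den Essen's map is built. -/
structure IsConjugationData (lam : ℂ) (a b g d e : ℂ → ℂ) : Prop where
  diff_a : Differentiable ℂ a
  diff_b : Differentiable ℂ b
  diff_g : Differentiable ℂ g
  diff_d : Differentiable ℂ d
  diff_e : Differentiable ℂ e
  a_zero : a 0 = 1
  d_zero : d 0 = 1
  a_mul : ∀ u, a (lam ^ 4 * u) = a u + u * g u
  b_mul : ∀ u, lam ^ 2 * b (lam ^ 4 * u) = b u + d u
  g_mul : ∀ u, lam ^ 2 * g (lam ^ 4 * u) = g u + a u + u * g u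
  d_mul : ∀ u, d (lam ^ 4 * u) = d u + u * b u + u * d u
  e_eq : ∀ u, u * e u = d u - a u
  det_eq : ∀ u, a u * d u - u * b u * g u = 1

/-- A function continuous at the origin and invariant under a scaling is constant. -/
theorem eq_apply_zero_of_apply_mul_eq {E : Type*} [NormedAddCommGroup E] [NormedSpace ℂ E]
    {lam : ℂ} (h0 : lam ≠ 0) (h1 : ‖lam‖ ≠ 1) {f : E → ℂ} (hf : ContinuousAt f 0)
    (h : ∀ u, f (lam • u) = f u) (u : E) : f u = f 0 := by
  have key : ∀ mu : ℂ, ‖mu‖ < 1 → (∀ u, f (mu • u) = f u) → f u = f 0 := by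
    intro mu hmu hi
    have hn : ∀ n : ℕ, f (mu ^ n • u) = f u := by
      intro n
      induction n with
      | zero => simp
      | succ n ih => rw [pow_succ', mul_smul, hi, ih]
    have ht : Tendsto (fun n : ℕ => mu ^ n • u) atTop (𝓝 0) := by
      simpa using (tendsto_pow_atTop_nhds_zero_of_norm_lt_one hmu).smul_const u
    have := hf.tendsto.comp ht
    simp only [Function.comp_def, hn] at this
    exact tendsto_nhds_unique tendsto_const_nhds this
  rcases lt_or_gt_of_ne h1 with hl | hl
  · exact key lam hl h
  · refine key lam⁻¹ (by rw [norm_inv]; exact inv_lt_one_of_one_lt₀ hl) fun u => ?_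
    rw [← h, smul_inv_smul₀ h0]

theorem exists_isConjugationData {lam : ℂ} (h0 : lam ≠ 0) (h1 : ‖lam‖ ≠ 1) :
    ∃ a b g d e, IsConjugationData lam a b g d e := by
  obtain ⟨b, hb, hb0, hbq⟩ := exists_entire_qDifference h0 h1
  have hl2 : lam ^ 2 - 1 ≠ 0 := pow_sub_one_ne_zero_of_norm_ne_one h1 (by norm_num)
  let g : ℂ → ℂ := fun u => b (lam ^ 2 * u)
  -- The argument is shifted back by one factor q so that a(qu) = λ²g(qu) - g(u).
  let a : ℂ → ℂ := fun u => lam ^ 2 * g u - b (lam ^ 2 * (u / lam ^ 4))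
  let d : ℂ → ℂ := fun u => lam ^ 2 * b (lam ^ 4 * u) - b u
  have hg : Differentiable ℂ g := by fun_prop
  have ha : Differentiable ℂ a := by fun_prop
  have hd : Differentiable ℂ d := by fun_prop
  have ha0 : a 0 = 1 := by
    simp only [a, g, mul_zero, zero_div, hb0]
    field_simp
  have hd0 : d 0 = 1 := by
    simp only [d, mul_zero, hb0]
    field_simp
  have ga : ∀ u, lam ^ 2 * g (lam ^ 4 * u) - g u = a (lam ^ 4 * u) := fun u => by
    simp only [a, g]
    rw [mul_div_cancel_left₀ _ (pow_ne_zero 4 h0)]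
  have haq : ∀ u, a (lam ^ 4 * u) = a u + u * g u := fun u => by
    rw [← ga]
    have := hbq (lam ^ 2 * (u / lam ^ 4))
    have e1 : lam ^ 4 * (lam ^ 2 * (u / lam ^ 4)) = lam ^ 2 * u := by field_simp
    rw [e1] at this
    have e2 : lam ^ 2 * (u / lam ^ 4) * lam ^ 2 = u := by field_simp
    simp only [a, g]
    rw [show lam ^ 2 * (lam ^ 4 * u) = lam ^ 4 * (lam ^ 2 * u) by ring]
    linear_combination this + b (lam ^ 2 * u) * e2
  have hbd : ∀ u, lam ^ 2 * b (lam ^ 4 * u) = b u + d u := fun u => by simp only [d]; ring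
  have hga : ∀ u, lam ^ 2 * g (lam ^ 4 * u) = g u + a u + u * g u := fun u => by
    linear_combination ga u + haq u
  have hdq : ∀ u, d (lam ^ 4 * u) = d u + u * b u + u * d u := fun u => by
    simp only [d]
    linear_combination hbq u
  refine ⟨a, b, g, d, dslope (fun u => d u - a u) 0, ha, hb, hg, hd, ?_, ha0, hd0, haq, hbd, hga,
    hdq, fun u => ?_, fun u => ?_⟩
  · exact differentiableOn_univ.mp ((Complex.differentiableOn_dslope univ_mem).mpr
      (hd.sub ha).differentiableOn)
  · have := sub_smul_dslope (fun u => d u - a u) 0 u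
    simpa [ha0, hd0] using this
  -- This determinant is invariant under u ↦ qu, hence equal to its value at 0.
  · have hc : ContinuousAt (fun u => a u * d u - u * b u * g u) 0 :=
      (show Differentiable ℂ (fun u => a u * d u - u * b u * g u) by fun_prop).continuous.continuousAt
    have h4 : ‖lam ^ 4‖ ≠ 1 := by
      rw [norm_pow]
      exact fun h => h1 ((pow_eq_one_iff_of_nonneg (norm_nonneg _) (by norm_num)).mp h)
    have := eq_apply_zero_of_apply_mul_eq (pow_ne_zero 4 h0) h4 hc (fun u => by
      simp only [smul_eq_mul]
      rw [haq, hdq]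
      linear_combination (-u) * (lam ^ 2 * g (lam ^ 4 * u)) * hbd u - u * (b u + d u) * hga u) u
    rw [this]
    simp [ha0, hd0]

/-! ### Weighted function spaces and the homological equation -/

/-- The products of a monomial of degree at least `d` with an entire function of the last
coordinate. -/
def weightedMonomials (d : ℕ) : Set ((Fin 4 → ℂ) → ℂ) :=
  {f | ∃ (n : Fin 4 → ℕ) (φ : ℂ → ℂ), d ≤ ∑ i, n i ∧ Differentiable ℂ φ ∧
    f = fun x => (∏ i, x i ^ n i) * φ (x 3)}

/-- The span of the products of a monomial of degree at least `d` with an entire function of the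
last coordinate. -/
def weightSpace (d : ℕ) : Submodule ℂ ((Fin 4 → ℂ) → ℂ) :=
  Submodule.span ℂ (weightedMonomials d)

theorem weightSpace_anti {c d : ℕ} (h : c ≤ d) : weightSpace d ≤ weightSpace c :=
  Submodule.span_mono fun _ ⟨n, φ, hn, hφ⟩ => ⟨n, φ, h.trans hn, hφ⟩

theorem mul_mem_weightSpace {c d : ℕ} {f g : (Fin 4 → ℂ) → ℂ} (hf : f ∈ weightSpace c)
    (hg : g ∈ weightSpace d) : f * g ∈ weightSpace (c + d) := by
  have h := Submodule.mul_mem_mul hf hg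
  rw [weightSpace, weightSpace, Submodule.span_mul_span] at h
  refine Submodule.span_mono ?_ h
  rintro _ ⟨f, ⟨n, φ, hn, hφ, rfl⟩, g, ⟨m, ψ, hm, hψ, rfl⟩, rfl⟩
  refine ⟨n + m, φ * ψ, ?_, hφ.mul hψ, ?_⟩
  · simp only [Pi.add_apply, Finset.sum_add_distrib]
    omega
  · ext x
    simp only [Pi.mul_apply, Pi.add_apply, pow_add, Finset.prod_mul_distrib]
    ring

theorem coord_mem_weightSpace (i : Fin 4) : (fun x => x i) ∈ weightSpace 1 := by
  refine Submodule.subset_span ⟨Pi.single i 1, fun _ => 1, ?_, by fun_prop, ?_⟩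
  · rw [Finset.sum_pi_single']
    simp
  · ext x
    rw [Finset.prod_eq_single i (fun j _ hj => by simp [hj]) (by simp)]
    simp

theorem comp_mem_weightSpace {φ : ℂ → ℂ} (hφ : Differentiable ℂ φ) :
    (fun x => φ (x 3)) ∈ weightSpace 0 :=
  Submodule.subset_span ⟨0, φ, by simp, hφ, by simp⟩

/-- A zero of φ at the origin splits off a factor x_3, leaving the entire quotient `dslope φ 0`. -/
theorem comp_mem_weightSpace_one {φ : ℂ → ℂ} (hφ : Differentiable ℂ φ) (h0 : φ 0 = 0) :
    (fun x => φ (x 3)) ∈ weightSpace 1 := by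
  have hd : Differentiable ℂ (dslope φ 0) := differentiableOn_univ.mp
    ((Complex.differentiableOn_dslope univ_mem).mpr hφ.differentiableOn)
  convert mul_mem_weightSpace (coord_mem_weightSpace 3) (comp_mem_weightSpace hd) using 1
  ext x
  simpa [h0] using (sub_smul_dslope φ 0 (x 3)).symm

theorem analyticOnNhd_of_mem_weightSpace {d : ℕ} {f : (Fin 4 → ℂ) → ℂ}
    (hf : f ∈ weightSpace d) : AnalyticOnNhd ℂ f Set.univ := by
  induction hf using Submodule.span_induction with
  | mem f hf =>
    obtain ⟨n, φ, -, hφ, rfl⟩ := hf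
    intro x _
    have hp : ∀ i : Fin 4, AnalyticAt ℂ (fun y : Fin 4 → ℂ => y i) x := fun i =>
      (ContinuousLinearMap.proj (R := ℂ) (φ := fun _ : Fin 4 => ℂ) i).analyticAt x
    refine AnalyticAt.mul ?_ (AnalyticAt.fun_comp (g := φ) (f := fun y : Fin 4 → ℂ => y 3)
      (hφ.analyticAt (x 3)) (hp 3))
    exact Finset.analyticAt_fun_prod _ fun i _ => (hp i).pow _
  | zero => exact analyticOnNhd_const
  | add f g _ _ hf hg => exact hf.add hg
  | smul c f _ hf => exact fun x hx => analyticAt_const.smul (hf x hx)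

theorem isBigO_of_mem_weightSpace {d : ℕ} {f : (Fin 4 → ℂ) → ℂ} (hf : f ∈ weightSpace d) :
    f =O[𝓝 0] fun x => ‖x - 0‖ ^ d := by
  induction hf using Submodule.span_induction with
  | mem f hf =>
    obtain ⟨n, φ, hn, hφ, rfl⟩ := hf
    have h1 : (fun x : Fin 4 → ℂ => ∏ i, x i ^ n i) =O[𝓝 0] fun x => ‖x - 0‖ ^ d := by
      refine IsBigO.of_bound 1 ?_
      filter_upwards [Metric.ball_mem_nhds (0 : Fin 4 → ℂ) one_pos] with x hx
      have hx1 : ‖x‖ ≤ 1 := by simpa using (Metric.mem_ball.mp hx).le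
      rw [sub_zero, norm_pow, norm_norm, one_mul, norm_prod]
      calc _ ≤ ∏ i, ‖x‖ ^ n i := Finset.prod_le_prod (fun _ _ => norm_nonneg _) fun i _ => by
            rw [norm_pow]
            exact pow_le_pow_left₀ (norm_nonneg _) (norm_le_pi_norm x i) _
        _ = ‖x‖ ^ ∑ i, n i := Finset.prod_pow_eq_pow_sum _ _ _
        _ ≤ ‖x‖ ^ d := pow_le_pow_of_le_one (norm_nonneg _) hx1 hn
    have h2 : (fun x : Fin 4 → ℂ => φ (x 3)) =O[𝓝 0] fun _ => (1 : ℝ) :=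
      ((hφ.continuous.comp (continuous_apply 3)).tendsto 0).isBigO_one ℝ
    simpa using h1.mul h2
  | zero => exact isBigO_zero _ _
  | add f g _ _ hf hg => exact hf.add hg
  | smul c f _ hf => exact hf.const_smul_left c

theorem apply_zero_of_mem_weightSpace {d : ℕ} (hd : d ≠ 0) {f : (Fin 4 → ℂ) → ℂ}
    (hf : f ∈ weightSpace d) : f 0 = 0 := by
  have h := (isBigO_of_mem_weightSpace hf).eq_zero_imp.self_of_nhds
  exact h (by simp [hd])

theorem hasFDerivAt_zero_of_mem_weightSpace {f : (Fin 4 → ℂ) → ℂ} (hf : f ∈ weightSpace 2) :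
    HasFDerivAt f (0 : (Fin 4 → ℂ) →L[ℂ] ℂ) 0 :=
  (isBigO_of_mem_weightSpace hf).hasFDerivAt one_lt_two

/-- On a monomial of degree m times φ(x_3), the equation reduces to λ^m ψ(λz) - λψ(z) = φ(z) in one
variable; linearity does the rest. -/
theorem exists_mem_weightSpace_solution {lam : ℂ} (h0 : lam ≠ 0) (h1 : ‖lam‖ ≠ 1)
    {f : (Fin 4 → ℂ) → ℂ} (hf : f ∈ weightSpace 2) :
    ∃ h ∈ weightSpace 2, ∀ y, h (lam • y) - lam * h y = f y := by
  induction hf using Submodule.span_induction with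
  | mem f hf =>
    obtain ⟨n, φ, hn, hφ, rfl⟩ := hf
    obtain ⟨ψ, hψ, he⟩ := exists_entire_solution h0 h1 hφ hn
    refine ⟨_, Submodule.subset_span ⟨n, ψ, hn, hψ, rfl⟩, fun y => ?_⟩
    simp only [Pi.smul_apply, smul_eq_mul, mul_pow, Finset.prod_mul_distrib,
      Finset.prod_pow_eq_pow_sum]
    rw [← he]
    ring
  | zero => exact ⟨0, zero_mem _, by simp⟩
  | add f g _ _ hf hg =>
    obtain ⟨p, hp, hp'⟩ := hf
    obtain ⟨q, hq, hq'⟩ := hg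
    refine ⟨p + q, add_mem hp hq, fun y => ?_⟩
    simp only [Pi.add_apply]
    rw [← hp', ← hq']
    ring
  | smul c f _ hf =>
    obtain ⟨p, hp, hp'⟩ := hf
    refine ⟨c • p, Submodule.smul_mem _ c hp, fun y => ?_⟩
    simp only [Pi.smul_apply, smul_eq_mul]
    rw [← hp']
    ring

/-! ### Rigidity of equivariant maps and uniqueness -/

section homogeneous

variable {E F : Type*} [NormedAddCommGroup E] [NormedSpace ℂ E] [NormedAddCommGroup F]
  [NormedSpace ℂ F]

/-- A function with vanishing 1-jet at the origin which is equivariant along the orbit of `x` under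
a contraction vanishes at `x`. -/
theorem eq_zero_of_apply_pow_smul {R : E → F} (hR : HasFDerivAt R (0 : E →L[ℂ] F) 0)
    (hR0 : R 0 = 0) {mu : ℂ} (hm0 : mu ≠ 0) (hm : ‖mu‖ < 1) {x : E}
    (h : ∀ n : ℕ, R (mu ^ (n + 1) • x) = mu • R (mu ^ n • x)) : R x = 0 := by
  have hn : ∀ n : ℕ, R (mu ^ n • x) = mu ^ n • R x := by
    intro n
    induction n with
    | zero => simp
    | succ n ih => rw [h, ih, smul_smul, pow_succ']
  have ht : Tendsto (fun n : ℕ => mu ^ n • x) atTop (𝓝 0) := by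
    simpa using (tendsto_pow_atTop_nhds_zero_of_norm_lt_one hm).smul_const x
  have ho : R =o[𝓝 0] fun x : E => x := by simpa [hR0] using hR.isLittleO
  have ho' := ho.comp_tendsto ht
  simp only [Function.comp_def, hn] at ho'
  rw [isLittleO_iff] at ho'
  by_contra hx
  have hpos : 0 < ‖R x‖ := norm_pos_iff.mpr hx
  -- The constant c makes c‖x‖ ≤ ‖R x‖/2; cancelling |μ|^n then gives ‖R x‖ ≤ ‖R x‖/2.
  obtain ⟨n, hn'⟩ := (ho' (c := ‖R x‖ / (2 * (‖x‖ + 1))) (by positivity)).exists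
  rw [norm_smul, norm_smul, mul_left_comm] at hn'
  have h3 := le_of_mul_le_mul_left hn' (norm_pos_iff.mpr (pow_ne_zero n hm0))
  have h4 : ‖R x‖ / (2 * (‖x‖ + 1)) * ‖x‖ ≤ ‖R x‖ / 2 := by
    rw [div_mul_eq_mul_div, div_le_div_iff₀ (by positivity) (by norm_num)]
    nlinarith [norm_nonneg x]
  linarith

/-- Iterating λ or λ⁻¹, whichever contracts, keeps the orbit of x inside the ball, so the equation
is needed only there. -/
theorem eq_zero_on_ball_of_apply_smul {R : E → F} (hR : HasFDerivAt R (0 : E →L[ℂ] F) 0)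
    (hR0 : R 0 = 0) {lam : ℂ} (h0 : lam ≠ 0) (h1 : ‖lam‖ ≠ 1) {r : ℝ}
    (h : ∀ x ∈ Metric.ball (0 : E) r, R (lam • x) = lam • R x) :
    ∀ x ∈ Metric.ball (0 : E) r, R x = 0 := by
  intro x hx
  rcases lt_or_gt_of_ne h1 with hl | hl
  · have hs : ∀ n : ℕ, lam ^ n • x ∈ Metric.ball (0 : E) r := fun n => by
      rw [mem_ball_zero_iff] at hx ⊢
      rw [norm_smul, norm_pow]
      exact (mul_le_of_le_one_left (norm_nonneg _)
        (pow_le_one₀ (norm_nonneg _) hl.le)).trans_lt hx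
    refine eq_zero_of_apply_pow_smul hR hR0 h0 hl fun n => ?_
    rw [← h _ (hs n), smul_smul, pow_succ']
  · have hl' : ‖lam⁻¹‖ < 1 := by
      rw [norm_inv]
      exact inv_lt_one_of_one_lt₀ hl
    have hs : ∀ n : ℕ, lam⁻¹ ^ n • x ∈ Metric.ball (0 : E) r := fun n => by
      rw [mem_ball_zero_iff] at hx ⊢
      rw [norm_smul, norm_pow]
      exact (mul_le_of_le_one_left (norm_nonneg _)
        (pow_le_one₀ (norm_nonneg _) hl'.le)).trans_lt hx
    refine eq_zero_of_apply_pow_smul hR hR0 (inv_ne_zero h0) hl' fun n => ?_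
    rw [eq_inv_smul_iff₀ h0, ← h _ (hs (n + 1)), smul_smul, pow_succ', mul_inv_cancel_left₀ h0]

theorem eq_zero_of_apply_smul {R : E → F} (hR : HasFDerivAt R (0 : E →L[ℂ] F) 0)
    (hR0 : R 0 = 0) {lam : ℂ} (h0 : lam ≠ 0) (h1 : ‖lam‖ ≠ 1)
    (h : ∀ x, R (lam • x) = lam • R x) (x : E) : R x = 0 :=
  eq_zero_on_ball_of_apply_smul hR hR0 h0 h1 (r := ‖x‖ + 1) (fun y _ => h y) x (by simp)

end homogeneous

/-- A local pre-conjugation agrees near the origin with every conjugation. -/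
theorem IsConjugation.eventuallyEq {n : ℕ} {lam : ℂ} {F K L : (Fin n → ℂ) → (Fin n → ℂ)}
    (hK : IsConjugation lam F K) (hL : IsLocalPreconjugation lam F L) (h0 : lam ≠ 0)
    (h1 : ‖lam‖ ≠ 1) : L =ᶠ[𝓝 0] K := by
  obtain ⟨-, G, ⟨hGK, hKG⟩, hG⟩ := hK.automorphism
  have hG0 : G 0 = 0 := by
    have := hGK 0
    rwa [hK.map_zero] at this
  have hGd : HasFDerivAt G (ContinuousLinearMap.id ℂ (Fin n → ℂ)) 0 := by
    have hd := (hG 0 (Set.mem_univ _)).differentiableAt.hasFDerivAt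
    have hc : HasFDerivAt (G ∘ K) ((fderiv ℂ G 0).comp (ContinuousLinearMap.id ℂ _)) 0 :=
      HasFDerivAt.comp 0 (by rwa [hK.map_zero]) hK.hasFDerivAt
    rw [hGK.comp_eq_id] at hc
    have := hc.unique (hasFDerivAt_id 0)
    rw [ContinuousLinearMap.comp_id] at this
    rwa [this] at hd
  have hM : HasFDerivAt (fun X => G (L X) - X) (0 : (Fin n → ℂ) →L[ℂ] (Fin n → ℂ)) 0 := by
    have hc : HasFDerivAt (G ∘ L) ((ContinuousLinearMap.id ℂ _).comp
        (ContinuousLinearMap.id ℂ _)) 0 :=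
      HasFDerivAt.comp 0 (by rwa [hL.map_zero]) hL.hasFDerivAt
    simpa using hc.sub (hasFDerivAt_id 0)
  obtain ⟨r, hr, hb⟩ := Metric.eventually_nhds_iff_ball.mp hL.conj
  -- With G = K⁻¹, the map G∘L commutes with scaling by λ: K(λG(LX)) = λF(LX) = L(λX).
  have := eq_zero_on_ball_of_apply_smul hM (by simp [hL.map_zero, hG0]) h0 h1 (r := r)
    fun X hX => by
      have e1 := hK.conj (G (L X))
      rw [hKG (L X), hb X hX] at e1
      rw [e1, hGK, smul_sub]
  filter_upwards [Metric.ball_mem_nhds 0 hr] with X hX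
  have e := sub_eq_zero.mp (this X hX)
  rw [← hKG (L X), e]

/-! ### The conjugation of f on ℂ⁴ -/

/-- The conjugation of van den Essen's map built from entire functions of `t⁴`. -/
def essenConj (c : ℂ) (a b g d e : ℂ → ℂ) (x : Fin 4 → ℂ) : Fin 4 → ℂ :=
  ![(a (x 3 ^ 4) + x 3 * b (x 3 ^ 4) * x 2) * x 0 + x 3 ^ 2 * b (x 3 ^ 4) * x 1,
    (x 3 ^ 2 * g (x 3 ^ 4) + x 3 ^ 3 * e (x 3 ^ 4) * x 2 - c * x 3 ^ 2 * a (x 3 ^ 4)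
        - b (x 3 ^ 4) * (x 2 + c * x 3 ^ 3) * x 2) * x 0
      + (d (x 3 ^ 4) - (x 2 + c * x 3 ^ 3) * x 3 * b (x 3 ^ 4)) * x 1,
    x 2 + c * x 3 ^ 3,
    x 3]

/-- The inverse of `essenConj`. -/
def essenConjInv (c : ℂ) (a b g d e : ℂ → ℂ) (y : Fin 4 → ℂ) : Fin 4 → ℂ :=
  ![(d (y 3 ^ 4) - y 2 * y 3 * b (y 3 ^ 4)) * y 0 - y 3 ^ 2 * b (y 3 ^ 4) * y 1,
    -(y 3 ^ 2 * g (y 3 ^ 4) + y 3 ^ 3 * e (y 3 ^ 4) * (y 2 - c * y 3 ^ 3)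
        - c * y 3 ^ 2 * a (y 3 ^ 4) - b (y 3 ^ 4) * y 2 * (y 2 - c * y 3 ^ 3)) * y 0
      + (a (y 3 ^ 4) + y 3 * b (y 3 ^ 4) * (y 2 - c * y 3 ^ 3)) * y 1,
    y 2 - c * y 3 ^ 3,
    y 3]

namespace IsConjugationData

variable {lam : ℂ} {a b g d e : ℂ → ℂ} (h : IsConjugationData lam a b g d e)
include h

theorem e_mul (t : ℂ) : t ^ 3 * (lam ^ 4 * e (lam ^ 4 * t ^ 4))
    = t ^ 3 * (e (t ^ 4) + b (t ^ 4) + d (t ^ 4) - g (t ^ 4)) := by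
  rcases eq_or_ne t 0 with rfl | ht
  · simp
  · refine mul_left_cancel₀ ht ?_
    linear_combination h.e_eq (lam ^ 4 * t ^ 4) + h.d_mul (t ^ 4) - h.a_mul (t ^ 4)
      - h.e_eq (t ^ 4)

/-- The (y_0, y_1)-block of the inverse is the adjugate of that of k; `e_eq` reduces the determinant
to ad - ubg = 1. -/
theorem areInverse (c : ℂ) : AreInverse (essenConj c a b g d e) (essenConjInv c a b g d e) := by
  constructor
  · intro x
    have h1 := h.e_eq (x 3 ^ 4)
    have h2 := h.det_eq (x 3 ^ 4)
    ext i
    fin_cases i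
    · simp [essenConj, essenConjInv]
      linear_combination (-(x 3 * b (x 3 ^ 4) * x 2) * h1 + h2) * x 0
    · simp [essenConj, essenConjInv]
      linear_combination (-(x 3 * b (x 3 ^ 4) * x 2) * h1 + h2) * x 1
    · simp [essenConj, essenConjInv]
    · simp [essenConj, essenConjInv]
  · intro y
    have h1 := h.e_eq (y 3 ^ 4)
    have h2 := h.det_eq (y 3 ^ 4)
    ext i
    fin_cases i
    · simp [essenConj, essenConjInv]
      linear_combination (-(y 3 * b (y 3 ^ 4) * (y 2 - c * y 3 ^ 3)) * h1 + h2) * y 0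
    · simp [essenConj, essenConjInv]
      linear_combination (-(y 3 * b (y 3 ^ 4) * (y 2 - c * y 3 ^ 3)) * h1 + h2) * y 1
    · simp [essenConj, essenConjInv]
    · simp [essenConj, essenConjInv]

theorem conj {c : ℂ} (hc : c * (lam ^ 2 - 1) = 1) (x : Fin 4 → ℂ) :
    lam • essenMap (essenConj c a b g d e x) = essenConj c a b g d e (lam • x) := by
  have hA := h.a_mul (x 3 ^ 4)
  have hB := h.b_mul (x 3 ^ 4)
  have hG := h.g_mul (x 3 ^ 4)
  have hD := h.d_mul (x 3 ^ 4)
  have hE := h.e_mul (x 3)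
  have hU := h.e_eq (x 3 ^ 4)
  rw [essenMap_eq_vec]
  ext i
  fin_cases i
  · simp [essenConj, mul_pow]
    linear_combination (-lam * x 0) * hA - lam * x 3 * (x 2 * x 0 + x 3 * x 1) * hB
      + lam * x 3 * x 2 * x 0 * hU
  · simp [essenConj, mul_pow]
    linear_combination (-lam * x 3 ^ 2 * x 0) * hG - lam * x 2 * x 0 * hE
      + c * lam ^ 3 * x 3 ^ 2 * x 0 * hA
      + lam * (x 2 + c * lam ^ 2 * x 3 ^ 3) * (x 2 * x 0 + x 3 * x 1) * hB - lam * x 1 * hD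
      - lam * x 2 * x 0 * (x 2 + c * x 3 ^ 3) * hU
      + lam * (x 3 ^ 2 * a (x 3 ^ 4) * x 0 + x 3 ^ 3 * (x 2 * x 0 + x 3 * x 1)
        * (b (x 3 ^ 4) + d (x 3 ^ 4)) + x 3 ^ 6 * g (x 3 ^ 4) * x 0) * hc
  · simp [essenConj, mul_pow]
    linear_combination (-lam * x 3 ^ 3) * hc
  · simp [essenConj]

/-- Since a(0) = d(0) = 1, the coefficients of x_0 and x_1 in k - id vanish at the origin and have
weight 1. -/
theorem sub_mem_weightSpace (c : ℂ) (i : Fin 4) :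
    (fun x => essenConj c a b g d e x i - x i) ∈ weightSpace 2 := by
  have X := coord_mem_weightSpace
  have Y : ∀ i, (fun x => x i) ∈ weightSpace 0 := fun i => weightSpace_anti zero_le_one (X i)
  have hA := comp_mem_weightSpace_one (φ := fun t => a (t ^ 4) - 1)
    ((h.diff_a.comp (differentiable_pow 4)).sub_const 1) (by simp [h.a_zero])
  have hD := comp_mem_weightSpace_one (φ := fun t => d (t ^ 4) - 1)
    ((h.diff_d.comp (differentiable_pow 4)).sub_const 1) (by simp [h.d_zero])
  have A := comp_mem_weightSpace (h.diff_a.comp (differentiable_pow 4))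
  have B := comp_mem_weightSpace (h.diff_b.comp (differentiable_pow 4))
  have G := comp_mem_weightSpace (h.diff_g.comp (differentiable_pow 4))
  have E := comp_mem_weightSpace (h.diff_e.comp (differentiable_pow 4))
  have m00 : ∀ {f g}, f ∈ weightSpace 0 → g ∈ weightSpace 0 → f * g ∈ weightSpace 0 :=
    mul_mem_weightSpace
  have m01 : ∀ {f g}, f ∈ weightSpace 0 → g ∈ weightSpace 1 → f * g ∈ weightSpace 1 :=
    mul_mem_weightSpace
  have m11 : ∀ {f g}, f ∈ weightSpace 1 → g ∈ weightSpace 1 → f * g ∈ weightSpace 2 :=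
    mul_mem_weightSpace
  have T3 := m00 (m00 (Y 3) (Y 3)) (Y 3)
  have Z := add_mem (Y 2) (Submodule.smul_mem _ c T3)
  have P := sub_mem (sub_mem (add_mem (m01 (m00 (Y 3) G) (X 3)) (m01 (m00 T3 E) (X 2)))
    (Submodule.smul_mem _ c (m01 (m00 (Y 3) A) (X 3)))) (m01 (m00 B Z) (X 2))
  have Q := sub_mem hD (m01 (m00 Z B) (X 3))
  match i with
  | 0 =>
    convert add_mem (m11 (add_mem hA (m01 (m00 (Y 3) B) (X 2))) (X 0))
      (m11 (m01 (m00 (Y 3) B) (X 3)) (X 1)) using 1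
    ext x
    simp only [essenConj, Pi.add_apply, Pi.mul_apply, Function.comp, Matrix.cons_val]
    ring
  | 1 =>
    convert add_mem (m11 P (X 0)) (m11 Q (X 1)) using 1
    ext x
    simp only [essenConj, Pi.add_apply, Pi.sub_apply, Pi.mul_apply, Pi.smul_apply, smul_eq_mul,
      Function.comp, Matrix.cons_val]
    ring
  | 2 =>
    convert Submodule.smul_mem _ c (m11 (m01 (Y 3) (X 3)) (X 3)) using 1
    ext x
    simp only [essenConj, Pi.mul_apply, Pi.smul_apply, smul_eq_mul, Matrix.cons_val]
    ring
  | 3 =>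
    convert zero_mem (weightSpace 2) using 1
    ext x
    simp [essenConj]

theorem mem_weightSpace_one (c : ℂ) (i : Fin 4) :
    (fun x => essenConj c a b g d e x i) ∈ weightSpace 1 := by
  convert add_mem (weightSpace_anti (by norm_num) (h.sub_mem_weightSpace c i))
    (coord_mem_weightSpace i) using 1
  ext x
  simp

theorem essenConjInv_mem_weightSpace (c : ℂ) (i : Fin 4) :
    (fun x => essenConjInv c a b g d e x i) ∈ weightSpace 0 := by
  have X : ∀ i, (fun x => x i) ∈ weightSpace 0 := fun i =>
    weightSpace_anti zero_le_one (coord_mem_weightSpace i)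
  have A := comp_mem_weightSpace (h.diff_a.comp (differentiable_pow 4))
  have B := comp_mem_weightSpace (h.diff_b.comp (differentiable_pow 4))
  have D := comp_mem_weightSpace (h.diff_d.comp (differentiable_pow 4))
  have G := comp_mem_weightSpace (h.diff_g.comp (differentiable_pow 4))
  have E := comp_mem_weightSpace (h.diff_e.comp (differentiable_pow 4))
  have m : ∀ {f g}, f ∈ weightSpace 0 → g ∈ weightSpace 0 → f * g ∈ weightSpace 0 :=
    mul_mem_weightSpace
  have T2 := m (X 3) (X 3)
  have T3 := m (X 3) T2
  have S : ∀ {f}, f ∈ weightSpace 0 → c • f ∈ weightSpace 0 := fun hf =>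
    Submodule.smul_mem _ c hf
  have Z := sub_mem (X 2) (S T3)
  match i with
  | 0 =>
    convert sub_mem (m (sub_mem D (m (m (X 2) (X 3)) B)) (X 0)) (m (m T2 B) (X 1)) using 1
    ext x
    simp only [essenConjInv, Pi.sub_apply, Pi.mul_apply, Function.comp, Matrix.cons_val]
    ring
  | 1 =>
    convert add_mem (neg_mem (m (sub_mem (sub_mem (add_mem (m T2 G) (m (m T3 E) Z))
      (S (m T2 A))) (m (m B (X 2)) Z)) (X 0)))
      (m (add_mem A (m (m (X 3) B) Z)) (X 1)) using 1
    ext x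
    simp only [essenConjInv, Pi.add_apply, Pi.sub_apply, Pi.mul_apply, Pi.neg_apply,
      Pi.smul_apply, smul_eq_mul, Function.comp, Matrix.cons_val]
    ring
  | 2 =>
    convert Z using 1
    ext x
    simp only [essenConjInv, Pi.sub_apply, Pi.mul_apply, Pi.smul_apply, smul_eq_mul,
      Matrix.cons_val]
    ring
  | 3 => exact X 3

end IsConjugationData

/-! ### Lifting the conjugation to ℂ¹⁶ -/

theorem exists_equivariant_solution {lam : ℂ} (h0 : lam ≠ 0) (h1 : ‖lam‖ ≠ 1)
    {k : (Fin 4 → ℂ) → Fin 4 → ℂ} (hk : ∀ i, (fun x => k x i) ∈ weightSpace 1) :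
    ∃ H : (Fin 4 → ℂ) → Fin 16 → ℂ, (∀ i, (fun y => H y i) ∈ weightSpace 2) ∧
      ∀ y, H (lam • y) - lam • H y = -lam • (essenD *ᵥ k y) ^ 3 := by
  have hD : ∀ i, (fun y => (essenD *ᵥ k y) i) ∈ weightSpace 1 := fun i => by
    convert sum_mem (S := weightSpace 1) (t := Finset.univ)
      fun j _ => Submodule.smul_mem _ (essenD i j) (hk j) using 1
    ext y
    simp [Matrix.mulVec, dotProduct]
  have hD3 : ∀ i, (fun y => -lam * (essenD *ᵥ k y) i ^ 3) ∈ weightSpace 2 := fun i => by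
    convert Submodule.smul_mem _ (-lam) (weightSpace_anti (show 2 ≤ 1 + 1 + 1 by norm_num)
      (mul_mem_weightSpace (mul_mem_weightSpace (hD i) (hD i)) (hD i))) using 1
    ext y
    simp only [Pi.smul_apply, Pi.mul_apply, smul_eq_mul]
    ring
  choose h hh he using fun i => exists_mem_weightSpace_solution h0 h1 (hD3 i)
  exact ⟨fun y i => h i y, hh, fun y => funext fun i => he i y⟩

theorem analyticOnNhd_of_forall_mem_weightSpace {m d : ℕ} {f : (Fin 4 → ℂ) → Fin m → ℂ}
    (hf : ∀ i, (fun y => f y i) ∈ weightSpace d) : AnalyticOnNhd ℂ f Set.univ :=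
  AnalyticOnNhd.pi fun i => analyticOnNhd_of_mem_weightSpace (hf i)

theorem hasFDerivAt_zero_of_forall_mem_weightSpace {m : ℕ} {f : (Fin 4 → ℂ) → Fin m → ℂ}
    (hf : ∀ i, (fun y => f y i) ∈ weightSpace 2) :
    HasFDerivAt f (0 : (Fin 4 → ℂ) →L[ℂ] (Fin m → ℂ)) 0 :=
  hasFDerivAt_pi.mpr fun i => hasFDerivAt_zero_of_mem_weightSpace (hf i)

theorem apply_zero_of_forall_mem_weightSpace {m : ℕ} {f : (Fin 4 → ℂ) → Fin m → ℂ}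
    (hf : ∀ i, (fun y => f y i) ∈ weightSpace 2) : f 0 = 0 :=
  funext fun i => apply_zero_of_mem_weightSpace two_ne_zero (hf i)

theorem analyticAt_essenB_mulVec (X : Fin 16 → ℂ) : AnalyticAt ℂ (fun X => essenB *ᵥ X) X :=
  (LinearMap.toContinuousLinearMap essenB.mulVecLin).analyticAt X

namespace IsConjugationData

variable {lam : ℂ} {a b g d e : ℂ → ℂ} (h : IsConjugationData lam a b g d e)
include h

/-- The conjugation of van den Essen's map lifts to the paired cubic-linear map. -/
theorem exists_isConjugation (h0 : lam ≠ 0) (h1 : ‖lam‖ ≠ 1) {c : ℂ}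
    (hc : c * (lam ^ 2 - 1) = 1) :
    ∃ K, IsConjugation lam (cubicLinear essenA) K ∧
      ∀ X, essenB *ᵥ K X = essenConj c a b g d e (essenB *ᵥ X) := by
  set k := essenConj c a b g d e with hk
  set k' := essenConjInv c a b g d e with hk'
  have hinv : AreInverse k k' := h.areInverse c
  obtain ⟨H, hH, hHe⟩ := exists_equivariant_solution h0 h1 (h.mem_weightSpace_one c)
  have hH0 := apply_zero_of_forall_mem_weightSpace hH
  have hHd := hasFDerivAt_zero_of_forall_mem_weightSpace hH
  have hHa := analyticOnNhd_of_forall_mem_weightSpace hH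
  have hk'a : AnalyticOnNhd ℂ k' Set.univ :=
    analyticOnNhd_of_forall_mem_weightSpace (h.essenConjInv_mem_weightSpace c)
  have hE : ∀ i, (fun y => (essenB *ᵥ H y - (k y - y)) i) ∈ weightSpace 2 := fun i => by
    convert sub_mem (sum_mem (S := weightSpace 2) (t := Finset.univ)
      fun j _ => Submodule.smul_mem _ (essenB i j) (hH j)) (h.sub_mem_weightSpace c i) using 1
    ext y
    simp [Matrix.mulVec, dotProduct, hk]
  -- BH and k - id solve the same equation, by f = id - B(D·)^{*3} and the conjugation of f; their
  -- difference is equivariant with zero 1-jet.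
  have hBH : ∀ y, essenB *ᵥ H y = k y - y := fun y => by
    refine sub_eq_zero.mp (eq_zero_of_apply_smul (hasFDerivAt_zero_of_forall_mem_weightSpace hE)
      (apply_zero_of_forall_mem_weightSpace hE) h0 h1 (fun x => ?_) y)
    have e1 := congrArg (fun v => essenB *ᵥ v) (hHe x)
    simp only [Matrix.mulVec_sub, Matrix.mulVec_smul] at e1
    have e2 := h.conj hc x
    rw [essenMap_eq, smul_sub] at e2
    rw [sub_eq_iff_eq_add.mp e1, hk, ← e2]
    module
  have hBK : ∀ X, essenB *ᵥ (X + H (essenB *ᵥ X)) = k (essenB *ᵥ X) := fun X => by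
    rw [Matrix.mulVec_add, hBH, add_sub_cancel]
  have hBG : ∀ Y, essenB *ᵥ (Y - H (k' (essenB *ᵥ Y))) = k' (essenB *ᵥ Y) := fun Y => by
    rw [Matrix.mulVec_sub, hBH, hinv.2, sub_sub_cancel]
  refine ⟨fun X => X + H (essenB *ᵥ X), ⟨⟨fun X _ => ?_, fun Y => Y - H (k' (essenB *ᵥ Y)),
    ⟨fun X => ?_, fun Y => ?_⟩, fun Y _ => ?_⟩, ?_, ?_, fun X => ?_⟩, hBK⟩
  · exact analyticAt_id.add ((hHa _ (Set.mem_univ _)).fun_comp (analyticAt_essenB_mulVec X))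
  · simp only [hBK, hinv.1 _, add_sub_cancel_right]
  · simp only [hBG, sub_add_cancel]
  · exact analyticAt_id.sub ((hHa _ (Set.mem_univ _)).fun_comp
      ((hk'a _ (Set.mem_univ _)).fun_comp (analyticAt_essenB_mulVec Y)))
  · simp [hH0]
  · have hB : HasFDerivAt (fun X => essenB *ᵥ X)
        (LinearMap.toContinuousLinearMap essenB.mulVecLin) 0 :=
      (LinearMap.toContinuousLinearMap essenB.mulVecLin).hasFDerivAt
    have hcomp : HasFDerivAt (H ∘ fun X => essenB *ᵥ X)
        ((0 : (Fin 4 → ℂ) →L[ℂ] (Fin 16 → ℂ)).comp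
          (LinearMap.toContinuousLinearMap essenB.mulVecLin)) 0 :=
      HasFDerivAt.comp 0 (by rwa [Matrix.mulVec_zero]) hB
    simpa using (hasFDerivAt_id (𝕜 := ℂ) (0 : Fin 16 → ℂ)).add hcomp
  · simp only [cubicLinear]
    rw [essenA_mulVec, hBK, Matrix.mulVec_smul, sub_eq_iff_eq_add.mp (hHe (essenB *ᵥ X))]
    module

/-! ### The conjugation is not polynomial -/

open Polynomial in
theorem not_exists_polynomial (h0 : lam ≠ 0) :
    ¬ ∃ P : ℂ[X], ∀ t, P.eval t = a (t ^ 4) := by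
  rintro ⟨P, hP⟩
  have hP0 : P ≠ 0 := by
    rintro rfl
    simpa [h.a_zero] using hP 0
  have hdeg : ∀ {r : ℂ}, r ≠ 0 → (P.comp (C r * X)).natDegree = P.natDegree := fun hr => by
    rw [natDegree_comp, natDegree_C_mul_X _ hr, mul_one]
  have hne : P.comp (C lam * X) ≠ 0 := fun hz => by
    have := congrArg (eval 0) hz
    simp [hP, h.a_zero] at this
  -- Eliminating g leaves an equation for a alone: the left side has degree deg P + 4, the right
  -- side at most deg P.
  have key : C (lam ^ 4) * X ^ 4 * P.comp (C lam * X) =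
      C (lam ^ 2) * P.comp (C (lam ^ 2) * X) - C (lam ^ 2 + lam ^ 4) * P.comp (C lam * X)
        + C (lam ^ 4) * P := by
    refine Polynomial.funext fun t => ?_
    simp only [eval_add, eval_sub, eval_mul, eval_comp, eval_C, eval_X, eval_pow, hP, mul_pow]
    have e1 := h.a_mul (t ^ 4)
    have e2 := h.a_mul (lam ^ 4 * t ^ 4)
    have e3 := h.g_mul (t ^ 4)
    rw [show (lam ^ 2) ^ 4 * t ^ 4 = lam ^ 4 * (lam ^ 4 * t ^ 4) by ring]
    linear_combination (-lam ^ 2) * e2 - lam ^ 4 * t ^ 4 * e3 + (lam ^ 4 + lam ^ 4 * t ^ 4) * e1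
  have hl := congrArg natDegree key
  have h4 : lam ^ 4 ≠ 0 := pow_ne_zero 4 h0
  rw [natDegree_mul (mul_ne_zero (by simpa using h0) (pow_ne_zero _ X_ne_zero)) hne,
    natDegree_C_mul_X_pow _ _ h4, hdeg h0] at hl
  have hr : (C (lam ^ 2) * P.comp (C (lam ^ 2) * X) - C (lam ^ 2 + lam ^ 4) * P.comp (C lam * X)
        + C (lam ^ 4) * P).natDegree ≤ P.natDegree := by
    refine natDegree_add_le_of_degree_le
      ((natDegree_sub_le _ _).trans (max_le ?_ ?_)) (natDegree_C_mul_le _ _)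
    · exact (natDegree_C_mul_le _ _).trans (hdeg (pow_ne_zero 2 h0)).le
    · exact (natDegree_C_mul_le _ _).trans (hdeg h0).le
  omega

/-- Since BC = I, along the line C(1, 0, 0, t) the first coordinate of BK is a(t⁴). -/
theorem not_isPolynomialMap (h0 : lam ≠ 0) {c : ℂ} {K : (Fin 16 → ℂ) → (Fin 16 → ℂ)}
    (hK : ∀ X, essenB *ᵥ K X = essenConj c a b g d e (essenB *ᵥ X)) : ¬ IsPolynomialMap K := by
  rintro ⟨p, hp⟩
  let y : ℂ → Fin 4 → ℂ := fun t => ![1, 0, 0, t]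
  let q : Fin 16 → Polynomial ℂ := fun i =>
    Polynomial.C (essenC i 0) + Polynomial.C (essenC i 3) * Polynomial.X
  refine h.not_exists_polynomial h0
    ⟨∑ j, Polynomial.C (essenB 0 j) * MvPolynomial.aeval q (p j), fun t => ?_⟩
  have hq : (fun i => Polynomial.aeval t (q i)) = essenC *ᵥ y t := by
    ext i
    simp [q, y, Matrix.mulVec, dotProduct, Fin.sum_univ_succ]
  have hy : essenB *ᵥ K (essenC *ᵥ y t) = essenConj c a b g d e (y t) := by
    rw [hK, Matrix.mulVec_mulVec, essenB_mul_essenC, Matrix.one_mulVec]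
  have h1 := congrFun hy 0
  have h2 : essenConj c a b g d e (y t) 0 = a (t ^ 4) := by simp [essenConj, y]
  rw [← h2, ← h1, Polynomial.eval_finsetSum]
  simp only [Matrix.mulVec, dotProduct] at hq ⊢
  refine Finset.sum_congr rfl fun j _ => ?_
  rw [Polynomial.eval_mul, Polynomial.eval_C, hp, ← hq, ← Polynomial.coe_aeval_eq_eval,
    MvPolynomial.comp_aeval_apply, MvPolynomial.aeval_eq_eval]

end IsConjugationData

theorem mainTheorem4 :
    -- van den Essen's map is a polynomial automorphism with the displayed inverse, of degree 7
    (IsPolynomialMap essenMap ∧ AreInverse essenMap essenInv ∧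
      IsPolynomialMapOfDegree essenInv 7) ∧
    -- it is cubic-homogeneous and paired to the cubic-linear map of `A` through `B` and `C`
    ((∀ x, essenMap x = x - essenB *ᵥ (essenD *ᵥ x) ^ 3) ∧ essenA * essenC = essenD ∧
      IsPairedThrough essenMap essenA essenB essenC) ∧
    (essenA ^ 2 ≠ 0 ∧ essenA ^ 3 = 0) ∧
    -- the cubic-linear map is a polynomial automorphism with inverse of degree at most 21
    (IsPolynomialMap (cubicLinear essenA) ∧
      ∃ G, AreInverse (cubicLinear essenA) G ∧ ∃ d ≤ 21, IsPolynomialMapOfDegree G d) ∧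
    -- its conjugation exists, is the only local pre-conjugation near the origin, and is an
    -- analytic automorphism that is not a polynomial map
    ∀ lam : ℂ, lam ≠ 0 → ‖lam‖ ≠ 1 →
      ∃ K : (Fin 16 → ℂ) → (Fin 16 → ℂ),
        IsConjugation lam (cubicLinear essenA) K ∧
        (∀ L, IsLocalPreconjugation lam (cubicLinear essenA) L → L =ᶠ[𝓝 0] K) ∧
        ¬ IsPolynomialMap K := by
  refine ⟨⟨isPolynomialMap_essenMap, areInverse_essenMap, isPolynomialMapOfDegree_essenInv⟩,
    ⟨essenMap_eq, essenA_mul_essenC, isPairedThrough_essen⟩, ⟨essenA_sq_ne_zero, essenA_cube⟩,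
    ⟨isPolynomialMap_cubicLinear _, _, areInverse_cubicLinear,
      exists_isPolynomialMapOfDegree_cubicLinear_inverse⟩, fun lam h0 h1 => ?_⟩
  obtain ⟨a, b, g, d, e, h⟩ := exists_isConjugationData h0 h1
  obtain ⟨K, hK, hBK⟩ := h.exists_isConjugation h0 h1 (c := (lam ^ 2 - 1)⁻¹)
    (inv_mul_cancel₀ (pow_sub_one_ne_zero_of_norm_ne_one h1 two_ne_zero))
  exact ⟨K, hK, fun L hL => hK.eventuallyEq hL h0 h1, h.not_isPolynomialMap h0 hBK⟩
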